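/- Let $m\ge 5$ be odd, and let $\mathcal C$ be a binary linear code of length $2^m$ with the following weight distribution (here and below, weights that are not listed do not occur): - weight $0$: multiplicity $1$; - weight $2^{m-1}-2^{(m-1)/2}$: multiplicity $(2^m-1)2^{m-1}$; - weight $2^{m-1}$: multiplicity $(2^m-1)(2^{m+1}-2^m+2)$; - weight $2^{m-1}+2^{(m-1)/2}$: multiplicity $(2^m-1)2^{m-1}$; - weight $2^m$: multiplicity $1$. Let $T$ be a set of $t$ coordinate positions, and let $\mathcal C_T$ be the shortened code of $\mathcal C$ on $T$, that is, the code obtained from the subcode $\{c\in\mathcal C : c_i=0 \text{ for all } i\in T\}$ by deleting the coordinates in $T$. An $[n,k,d]$ code is a linear code of length $n$, dimension $k$ and minimum Hamming distance $d$. 1. If $t=1$, then $\mathcal C_T$ is a $[2^m-1,\,2m,\,2^{m-1}-2^{(m-1)/2}]$ binary linear code with the weight distribution: weight $0$: $1$; weight $2^{m-1}-2^{(m-1)/2}$: $2^{(m-5)/2}(2^m-1)(2+2^{(1+m)/2})$; weight $2^{m-1}$: $-1+2^{m-1}+2^{2m-1}$; weight $2^{m-1}+2^{(m-1)/2}$: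 $2^{(m-5)/2}(2^m-1)(-2+2^{(1+m)/2})$. 2. If $t=2$, then $\mathcal C_T$ is a $[2^m-2,\,2m-1,\,2^{m-1}-2^{(m-1)/2}]$ binary linear code with the weight distribution: weight $0$: $1$; weight $2^{m-1}-2^{(m-1)/2}$: $2^{(m-7)/2}(-4+2^{2+m}+2^{(1+3m)/2})$; weight $2^{m-1}$: $-1+2^{2m-2}$; weight $2^{m-1}+2^{(m-1)/2}$: $2^{(m-7)/2}(4-2^{2+m}+2^{(1+3m)/2})$. 3. If $t=3$, then $\mathcal C_T$ is a $[2^m-3,\,2m-2,\,2^{m-1}-2^{(m-1)/2}]$ binary linear code with the weight distribution: weight $0$: $1$; weight $2^{m-1}-2^{(m-1)/2}$: $-2^{(m-3)/2}+3\cdot 2^{(3m-7)/2}+2^{m-3}+2^{2m-4}$; weight $2^{m-1}$: $(-1+2^{m-2})(1+2^{m-1})$; weight $2^{m-1}+2^{(m-1)/2}$: $2^{(m-3)/2}-3\cdot 2^{(3m-7)/2}+2^{m-3}+2^{2m-4}$. -/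

import Mathlib

/-- The code punctured on `T`: the coordinates in `T` are deleted from every codeword. The remaining
coordinate positions are the elements of `{i // i ∉ T}`. -/
def puncturedCode {F ι : Type*} [Field F] (C : Submodule F (ι → F)) (T : Finset ι) :
    Submodule F ({i // i ∉ T} → F) :=
  C.map (LinearMap.funLeft F F (Subtype.val : {i // i ∉ T} → ι))

/-- `C(T)`: the codewords of `C` that are zero on `T`. -/
def vanishingSubcode {F ι : Type*} [Field F] (C : Submodule F (ι → F)) (T : Finset ι) :
    Submodule F (ι → F) where
  carrier := {c | c ∈ C ∧ ∀ i ∈ T, c i = 0}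
  add_mem' := by
    rintro a b ⟨ha, ha0⟩ ⟨hb, hb0⟩
    exact ⟨C.add_mem ha hb, fun i hi => by simp [ha0 i hi, hb0 i hi]⟩
  zero_mem' := ⟨C.zero_mem, fun _ _ => rfl⟩
  smul_mem' := by
    rintro r a ⟨ha, ha0⟩
    exact ⟨C.smul_mem r ha, fun i hi => by simp [ha0 i hi]⟩

/-- The shortened code `C_T`: the subcode `C(T)` punctured on `T`. -/
def shortenedCode {F ι : Type*} [Field F] (C : Submodule F (ι → F)) (T : Finset ι) :
    Submodule F ({i // i ∉ T} → F) :=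
  puncturedCode (vanishingSubcode C T) T

/-- `A_w(C)`: the number of codewords of Hamming weight `w`. -/
noncomputable def weightCount {F ι : Type*} [Field F] [DecidableEq F] [Fintype ι]
    (C : Submodule F (ι → F)) (w : ℕ) : ℕ :=
  {c : ι → F | c ∈ C ∧ hammingNorm c = w}.ncard

/-- `C` is an `[n, k, d]` linear code: length `n`, dimension `k`, minimum Hamming distance `d`. -/
def IsLinearCodeWithParams {F ι : Type*} [Field F] [DecidableEq F] [Fintype ι]
    (C : Submodule F (ι → F)) (n k d : ℕ) : Prop :=
  Fintype.card ι = n ∧ Module.finrank F C = k ∧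
    IsLeast {r : ℕ | ∃ x ∈ C, ∃ y ∈ C, x ≠ y ∧ hammingDist x y = r} d

/-- The number of codewords of each weight `w` is `A w`. (The values of `A` are rational since
formulas for multiplicities may involve subtraction and negative powers of two.) -/
def HasWeightDistribution {F ι : Type*} [Field F] [DecidableEq F] [Fintype ι]
    (C : Submodule F (ι → F)) (A : ℕ → ℚ) : Prop :=
  ∀ w : ℕ, (weightCount C w : ℚ) = A w

/-! The following weight distributions are used for odd `m ≥ 5` only, where all the subtractions and
divisions in weights and exponents are exact. A weight that is not listed has multiplicity zero. -/

/-- The weight distribution of the code `C` of length `2 ^ m`. -/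
def weightTable (m w : ℕ) : ℚ :=
  if w = 0 then 1
  else if w = 2 ^ (m - 1) - 2 ^ ((m - 1) / 2) then (2 ^ m - 1) * 2 ^ (m - 1)
  else if w = 2 ^ (m - 1) then (2 ^ m - 1) * (2 ^ (m + 1) - 2 ^ m + 2)
  else if w = 2 ^ (m - 1) + 2 ^ ((m - 1) / 2) then (2 ^ m - 1) * 2 ^ (m - 1)
  else if w = 2 ^ m then 1
  else 0

/-- The weight distribution of `C_T` for `t = 1`. -/
def weightTableOne (m w : ℕ) : ℚ :=
  if w = 0 then 1
  else if w = 2 ^ (m - 1) - 2 ^ ((m - 1) / 2) then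
    2 ^ ((m - 5) / 2) * (2 ^ m - 1) * (2 + 2 ^ ((1 + m) / 2))
  else if w = 2 ^ (m - 1) then -1 + 2 ^ (m - 1) + 2 ^ (2 * m - 1)
  else if w = 2 ^ (m - 1) + 2 ^ ((m - 1) / 2) then
    2 ^ ((m - 5) / 2) * (2 ^ m - 1) * (-2 + 2 ^ ((1 + m) / 2))
  else 0

/-- The weight distribution of `C_T` for `t = 2`. The exponent `(m - 7) / 2` is an integer that is
negative for `m = 5`. -/
def weightTableTwo (m w : ℕ) : ℚ :=
  if w = 0 then 1
  else if w = 2 ^ (m - 1) - 2 ^ ((m - 1) / 2) then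
    2 ^ (((m : ℤ) - 7) / 2) * (-4 + 2 ^ (2 + m) + 2 ^ ((1 + 3 * m) / 2))
  else if w = 2 ^ (m - 1) then -1 + 2 ^ (2 * m - 2)
  else if w = 2 ^ (m - 1) + 2 ^ ((m - 1) / 2) then
    2 ^ (((m : ℤ) - 7) / 2) * (4 - 2 ^ (2 + m) + 2 ^ ((1 + 3 * m) / 2))
  else 0

/-- The weight distribution of `C_T` for `t = 3`. -/
def weightTableThree (m w : ℕ) : ℚ :=
  if w = 0 then 1
  else if w = 2 ^ (m - 1) - 2 ^ ((m - 1) / 2) then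
    -2 ^ ((m - 3) / 2) + 3 * 2 ^ ((3 * m - 7) / 2) + 2 ^ (m - 3) + 2 ^ (2 * m - 4)
  else if w = 2 ^ (m - 1) then (-1 + 2 ^ (m - 2)) * (1 + 2 ^ (m - 1))
  else if w = 2 ^ (m - 1) + 2 ^ ((m - 1) / 2) then
    2 ^ ((m - 3) / 2) - 3 * 2 ^ ((3 * m - 7) / 2) + 2 ^ (m - 3) + 2 ^ (2 * m - 4)
  else 0

/-! Write `n = 2 ^ m` and `S(c) = n - 2 wt(c)`, a sum of `n` signs. Expanding `S ^ 4` over the code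
gives a sum over quadruples of positions of character sums, each equal to `|C|` or `0`. Quadruples
that pair off always give `|C|`, so the fourth moment is at least `|C| (3 n² - 2 n)`. The given
weights attain this bound exactly, hence no other quadruple contributes: the dual code has no word
of weight 2 or 4 (`fourthSum_eq`). The word of weight `n` is all-one, so the dual has no odd-weight
words either.

Consequently products of few signs have known means on `C`. The indicator of vanishing on `T` is the
product of `(1 + sign) / 2` over `T`; expanding it for `t ≤ 3` gives the moments of `S` of order 0,
1 and 2 on the subcode (`two_pow_mul_sum_vanishingSubcode`). The all-one word does not vanish on
`T`, so only three nonzero weights remain, and three moments determine their multiplicities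
(`hasWeightDistribution_shortenedCode`). Dimension and minimum distance are read off the
distribution. -/

/-- The nontrivial additive character of `ZMod 2`, with values in `ℚ`. -/
def binSign (a : ZMod 2) : ℚ := if a = 0 then 1 else -1

lemma binSign_add (a b : ZMod 2) : binSign (a + b) = binSign a * binSign b := by
  have h : ∀ a b : ZMod 2, (a = 0 ∧ b = 0 ∧ a + b = 0) ∨ (a = 0 ∧ b ≠ 0 ∧ a + b ≠ 0) ∨
      (a ≠ 0 ∧ b = 0 ∧ a + b ≠ 0) ∨ (a ≠ 0 ∧ b ≠ 0 ∧ a + b = 0) := by decide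
  rcases h a b with ⟨h1, h2, h3⟩ | ⟨h1, h2, h3⟩ | ⟨h1, h2, h3⟩ | ⟨h1, h2, h3⟩ <;>
    simp [binSign, h1, h2, h3]

lemma binSign_mul_self (a : ZMod 2) : binSign a * binSign a = 1 := by
  unfold binSign; split_ifs <;> norm_num

lemma binSign_eq_or (a : ZMod 2) : binSign a = 1 ∨ binSign a = -1 := by
  unfold binSign; split_ifs <;> simp

lemma binSign_one_add (a : ZMod 2) : binSign (1 + a) = - binSign a := by
  rw [binSign_add]; simp [show binSign 1 = -1 from if_neg one_ne_zero]

/-- The number of zeros minus the number of ones of a binary word. -/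
def signSum {ι : Type*} [Fintype ι] (c : ι → ZMod 2) : ℚ := ∑ i, binSign (c i)

/-! ### The fourth moment and short parity checks -/

section Moments

variable {ι : Type*} [Fintype ι]

lemma signSum_eq (c : ι → ZMod 2) :
    signSum c = Fintype.card ι - 2 * (hammingNorm c : ℚ) := by
  have h : ∀ i, binSign (c i) = 1 - 2 * (if c i ≠ 0 then 1 else 0) := by
    intro i
    unfold binSign
    by_cases h : c i = 0 <;> simp [h]
    norm_num
  simp only [signSum, h, Finset.sum_sub_distrib, ← Finset.mul_sum, Finset.sum_boole]
  simp [hammingNorm]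

/-- The sum of a character of a finite group with values `1` and `-1` is nonnegative. -/
lemma sum_sign_character {G : Type*} [AddCommGroup G] [Fintype G] (ψ : G → ℚ)
    (hadd : ∀ a b, ψ (a + b) = ψ a * ψ b) (hval : ∀ a, ψ a = 1 ∨ ψ a = -1) :
    0 ≤ ∑ a, ψ a := by
  by_cases h : ∃ d, ψ d = -1
  · obtain ⟨d, hd⟩ := h
    -- Translation by `d` negates the sum and also preserves it, so it is zero.
    have h1 : ∑ a, ψ (a + d) = ∑ a, ψ a := Equiv.sum_comp (Equiv.addRight d) ψ
    simp only [hadd, hd, mul_neg, mul_one, Finset.sum_neg_distrib] at h1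
    linarith
  · push Not at h
    exact Finset.sum_nonneg fun a _ => by
      rcases hval a with h1 | h1
      · simp [h1]
      · exact absurd h1 (h a)

/-- `1` if the four indices can be paired off into equal ones, and `0` otherwise. -/
def pairing [DecidableEq ι] (i j k l : ι) : ℚ :=
  (if i = j then 1 else 0) * (if k = l then 1 else 0) +
  (if i = k then 1 else 0) * (if j = l then 1 else 0) +
  (if i = l then 1 else 0) * (if j = k then 1 else 0) -
  2 * ((if i = j then 1 else 0) * ((if i = k then 1 else 0) * (if i = l then 1 else 0)))

lemma sum_pairing [DecidableEq ι] :
    ∑ i : ι, ∑ j : ι, ∑ k : ι, ∑ l : ι, pairing i j k l =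
      3 * (Fintype.card ι : ℚ) ^ 2 - 2 * Fintype.card ι := by
  simp only [pairing, Finset.sum_sub_distrib, Finset.sum_add_distrib, ← Finset.mul_sum,
    Finset.sum_ite_eq, Finset.mem_univ, if_true, mul_one, Finset.sum_const, Finset.card_univ,
    nsmul_eq_mul]
  simp
  ring

variable (C : Submodule (ZMod 2) (ι → ZMod 2)) [Fintype C]

/-- The sum over the code of the product of the signs in four positions. -/
def fourthSum (i j k l : ι) : ℚ :=
  ∑ c : C, binSign (c.1 i) * binSign (c.1 j) * (binSign (c.1 k) * binSign (c.1 l))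

omit [Fintype ι] in
lemma fourthSum_nonneg (i j k l : ι) : 0 ≤ fourthSum C i j k l := by
  refine sum_sign_character _ (fun a b => ?_) (fun a => ?_)
  · simp only [Submodule.coe_add, Pi.add_apply, binSign_add]; ring
  · rcases binSign_eq_or (a.1 i) with h1 | h1 <;> rcases binSign_eq_or (a.1 j) with h2 | h2 <;>
      rcases binSign_eq_or (a.1 k) with h3 | h3 <;>
      rcases binSign_eq_or (a.1 l) with h4 | h4 <;> simp [h1, h2, h3, h4]

-- When the indices pair off, every summand of `fourthSum` is a product of squares of signs, hence
-- 1. Otherwise the left side is zero and a character sum is nonnegative.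
omit [Fintype ι] in
lemma card_mul_pairing_le [DecidableEq ι] (i j k l : ι) :
    (Fintype.card C : ℚ) * pairing i j k l ≤ fourthSum C i j k l := by
  have key : ∀ c : ι → ZMod 2, ((i = j ∧ k = l) ∨ (i = k ∧ j = l) ∨ (i = l ∧ j = k)) →
      binSign (c i) * binSign (c j) * (binSign (c k) * binSign (c l)) = 1 := by
    rintro c (⟨rfl, rfl⟩ | ⟨rfl, rfl⟩ | ⟨rfl, rfl⟩)
    · simp [binSign_mul_self]
    · linear_combination (binSign (c j) * binSign (c j)) * binSign_mul_self (c i) +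
        binSign_mul_self (c j)
    · linear_combination (binSign (c j) * binSign (c j)) * binSign_mul_self (c i) +
        binSign_mul_self (c j)
  have hC : (0 : ℚ) ≤ Fintype.card C := Nat.cast_nonneg _
  by_cases h : (i = j ∧ k = l) ∨ (i = k ∧ j = l) ∨ (i = l ∧ j = k)
  · have h1 : fourthSum C i j k l = Fintype.card C := by
      simp [fourthSum, key _ h]
    have h2 : pairing i j k l ≤ 1 := by
      unfold pairing
      split_ifs <;> first | (norm_num; done) | (exfalso; grind)
    rw [h1]
    nlinarith
  · have h2 : pairing i j k l = 0 := by
      push Not at h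
      unfold pairing
      split_ifs <;> first | (norm_num; done) | (exfalso; grind)
    rw [h2, mul_zero]
    exact fourthSum_nonneg C i j k l

lemma sum_signSum_pow_four :
    ∑ c : C, signSum c.1 ^ 4 = ∑ i, ∑ j, ∑ k, ∑ l, fourthSum C i j k l := by
  have h : ∀ c : C, signSum c.1 ^ 4 = ∑ i, ∑ j, ∑ k, ∑ l,
      binSign (c.1 i) * binSign (c.1 j) * (binSign (c.1 k) * binSign (c.1 l)) := by
    intro c
    simp only [← Finset.mul_sum, ← Finset.sum_mul]
    simp only [signSum]
    ring
  simp only [h, fourthSum]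
  rw [Finset.sum_comm]
  refine Finset.sum_congr rfl fun i _ => ?_
  rw [Finset.sum_comm]
  refine Finset.sum_congr rfl fun j _ => ?_
  rw [Finset.sum_comm]
  refine Finset.sum_congr rfl fun k _ => ?_
  rw [Finset.sum_comm]

/-- If the fourth moment is as small as possible, the code has no nonzero parity check of weight
two or four. -/
lemma fourthSum_eq [DecidableEq ι]
    (h4 : ∑ c : C, signSum c.1 ^ 4 =
      Fintype.card C * (3 * (Fintype.card ι : ℚ) ^ 2 - 2 * Fintype.card ι)) (i j k l : ι) :
    fourthSum C i j k l = Fintype.card C * pairing i j k l := by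
  rw [sum_signSum_pow_four, ← sum_pairing] at h4
  simp only [Finset.mul_sum] at h4
  have hle := card_mul_pairing_le C
  -- Equal totals under termwise inequality force termwise equality; this is peeled off one index at
  -- a time.
  have h1 := (Finset.sum_eq_sum_iff_of_le fun i _ => Finset.sum_le_sum fun j _ =>
    Finset.sum_le_sum fun k _ => Finset.sum_le_sum fun l _ => hle i j k l).1 h4.symm i
      (Finset.mem_univ i)
  have h2 := (Finset.sum_eq_sum_iff_of_le fun j _ =>
    Finset.sum_le_sum fun k _ => Finset.sum_le_sum fun l _ => hle i j k l).1 h1 j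
      (Finset.mem_univ j)
  have h3 := (Finset.sum_eq_sum_iff_of_le fun k _ => Finset.sum_le_sum fun l _ =>
    hle i j k l).1 h2 k (Finset.mem_univ k)
  exact ((Finset.sum_eq_sum_iff_of_le fun l _ => hle i j k l).1 h3 l (Finset.mem_univ l)).symm

omit [Fintype ι] in
/-- An odd function has mean zero on a self-complementary code. -/
lemma sum_eq_zero_of_odd (hone : (1 : ι → ZMod 2) ∈ C) (f : (ι → ZMod 2) → ℚ)
    (hf : ∀ c, f (1 + c) = - f c) : ∑ c : C, f c.1 = 0 := by
  have h1 : ∑ c : C, f ((⟨1, hone⟩ + c : C) : ι → ZMod 2) = ∑ c : C, f c.1 :=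
    Equiv.sum_comp (Equiv.addLeft (⟨1, hone⟩ : C)) fun c : C => f c.1
  simp only [Submodule.coe_add, hf, Finset.sum_neg_distrib] at h1
  linarith

lemma signSum_one_add (c : ι → ZMod 2) : signSum (1 + c) = - signSum c := by
  simp [signSum, binSign_one_add]

/-! ### Mean values of sign products when short parity checks are absent -/

variable {C}

omit [Fintype ι] in
lemma sum_two_signs [DecidableEq ι]
    (h4 : ∀ i j k l : ι, fourthSum C i j k l = Fintype.card C * pairing i j k l)
    {i j : ι} (hij : i ≠ j) : ∑ c : C, binSign (c.1 i) * binSign (c.1 j) = 0 := by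
  -- The repeated sign at `i` squares to 1, turning four signs into two.
  have h := h4 i j i i
  simpa [fourthSum, binSign_mul_self, pairing, hij, hij.symm] using h

/-- Padding with a squared sign turns each term into a `fourthSum`; only the diagonal term `j = i`
survives. -/
lemma sum_sign_mul_signSum [DecidableEq ι]
    (h4 : ∀ i j k l : ι, fourthSum C i j k l = Fintype.card C * pairing i j k l) (i : ι) :
    ∑ c : C, binSign (c.1 i) * signSum c.1 = Fintype.card C := by
  have h : ∀ c : C, binSign (c.1 i) * signSum c.1 =
      ∑ j, binSign (c.1 i) * binSign (c.1 i) * (binSign (c.1 i) * binSign (c.1 j)) := fun c => by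
    simp [binSign_mul_self, signSum, Finset.mul_sum]
  simp only [h]
  rw [Finset.sum_comm]
  change ∑ j, fourthSum C i i i j = _
  simp only [h4, ← Finset.mul_sum]
  simp [pairing, Finset.sum_add_distrib]
  norm_num

/-- Three distinct indices cannot be paired off by adding a fourth. -/
lemma sum_three_signs_mul_signSum [DecidableEq ι]
    (h4 : ∀ i j k l : ι, fourthSum C i j k l = Fintype.card C * pairing i j k l)
    {i j k : ι} (hij : i ≠ j) (hik : i ≠ k) (hjk : j ≠ k) :
    ∑ c : C, binSign (c.1 i) * binSign (c.1 j) * binSign (c.1 k) * signSum c.1 = 0 := by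
  simp only [signSum, Finset.mul_sum]
  rw [Finset.sum_comm]
  refine Finset.sum_eq_zero fun l _ => ?_
  have h := h4 i j k l
  simp only [fourthSum, pairing, hij, hik, hjk, if_false, zero_mul, mul_zero, add_zero,
    sub_zero] at h
  simpa only [mul_assoc] using h

/-- The factor 2 counts the pairs `(k, l) = (i, j)` and `(j, i)`, the only ones that pair off with
distinct `i`, `j`. -/
lemma sum_two_signs_mul_signSum_sq [DecidableEq ι]
    (h4 : ∀ i j k l : ι, fourthSum C i j k l = Fintype.card C * pairing i j k l)
    {i j : ι} (hij : i ≠ j) :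
    ∑ c : C, binSign (c.1 i) * binSign (c.1 j) * signSum c.1 ^ 2 = 2 * Fintype.card C := by
  have h : ∀ c : C, binSign (c.1 i) * binSign (c.1 j) * signSum c.1 ^ 2 =
      ∑ k, ∑ l, binSign (c.1 i) * binSign (c.1 j) * (binSign (c.1 k) * binSign (c.1 l)) :=
    fun c => by simp only [← Finset.mul_sum, ← Finset.sum_mul, signSum, sq]
  simp only [h]
  rw [Finset.sum_comm]
  simp only [Finset.sum_comm (s := (Finset.univ : Finset C))]
  change ∑ k, ∑ l, fourthSum C i j k l = _
  simp only [h4, ← Finset.mul_sum]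
  simp [pairing, hij, Finset.sum_add_distrib]
  ring

lemma sum_signSum_sq [DecidableEq ι]
    (h4 : ∀ i j k l : ι, fourthSum C i j k l = Fintype.card C * pairing i j k l) :
    ∑ c : C, signSum c.1 ^ 2 = Fintype.card ι * Fintype.card C := by
  have h : ∀ c : C, signSum c.1 ^ 2 = ∑ i, binSign (c.1 i) * signSum c.1 := fun c => by
    rw [← Finset.sum_mul, sq]; rfl
  simp only [h]
  rw [Finset.sum_comm]
  simp [sum_sign_mul_signSum h4]

omit [Fintype ι] in
lemma sum_sign (hone : (1 : ι → ZMod 2) ∈ C) (i : ι) : ∑ c : C, binSign (c.1 i) = 0 :=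
  sum_eq_zero_of_odd C hone (fun c => binSign (c i)) fun c => by simp [binSign_one_add]

omit [Fintype ι] in
lemma sum_three_signs (hone : (1 : ι → ZMod 2) ∈ C) (i j k : ι) :
    ∑ c : C, binSign (c.1 i) * binSign (c.1 j) * binSign (c.1 k) = 0 :=
  sum_eq_zero_of_odd C hone (fun c => binSign (c i) * binSign (c j) * binSign (c k))
    fun c => by simp [binSign_one_add]

lemma sum_signSum (hone : (1 : ι → ZMod 2) ∈ C) : ∑ c : C, signSum c.1 = 0 :=
  sum_eq_zero_of_odd C hone signSum signSum_one_add

lemma sum_two_signs_mul_signSum (hone : (1 : ι → ZMod 2) ∈ C) (i j : ι) :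
    ∑ c : C, binSign (c.1 i) * binSign (c.1 j) * signSum c.1 = 0 :=
  sum_eq_zero_of_odd C hone (fun c => binSign (c i) * binSign (c j) * signSum c)
    fun c => by simp [binSign_one_add, signSum_one_add]

lemma sum_sign_mul_signSum_sq (hone : (1 : ι → ZMod 2) ∈ C) (i : ι) :
    ∑ c : C, binSign (c.1 i) * signSum c.1 ^ 2 = 0 :=
  sum_eq_zero_of_odd C hone (fun c => binSign (c i) * signSum c ^ 2)
    fun c => by simp [binSign_one_add, signSum_one_add]

lemma sum_three_signs_mul_signSum_sq (hone : (1 : ι → ZMod 2) ∈ C) (i j k : ι) :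
    ∑ c : C, binSign (c.1 i) * binSign (c.1 j) * binSign (c.1 k) * signSum c.1 ^ 2 = 0 :=
  sum_eq_zero_of_odd C hone
    (fun c => binSign (c i) * binSign (c j) * binSign (c k) * signSum c ^ 2)
    fun c => by simp [binSign_one_add, signSum_one_add]

/-! ### Sums over subcodes and by weight -/

/-- Summation over the subcode vanishing on `T`, by its indicator function. -/
lemma two_pow_mul_sum_vanishingSubcode [DecidableEq ι] (T : Finset ι)
    [Fintype (vanishingSubcode C T)] (f : (ι → ZMod 2) → ℚ) :
    2 ^ T.card * ∑ c : vanishingSubcode C T, f c.1 =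
      ∑ c : C, (∏ i ∈ T, (1 + binSign (c.1 i))) * f c.1 := by
  classical
  have hsum : ∀ (D : Submodule (ZMod 2) (ι → ZMod 2)) [Fintype D] (g : (ι → ZMod 2) → ℚ),
      ∑ c : D, g c.1 = ∑ c, if c ∈ D then g c else 0 := by
    intro D _ g
    rw [← Finset.sum_filter]
    exact (Finset.sum_subtype _ (by simp) g).symm
  rw [hsum _ f, hsum C fun c => (∏ i ∈ T, (1 + binSign (c i))) * f c, Finset.mul_sum]
  refine Finset.sum_congr rfl fun c _ => ?_
  by_cases hc : c ∈ C
  · by_cases h : ∀ i ∈ T, c i = 0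
    · have hm : c ∈ vanishingSubcode C T := ⟨hc, h⟩
      have hp : ∏ i ∈ T, (1 + binSign (c i)) = 2 ^ T.card := by
        rw [← Finset.prod_const]
        exact Finset.prod_congr rfl fun i hi => by simp [binSign, h i hi]; norm_num
      simp [hc, hm, hp]
    · have hm : c ∉ vanishingSubcode C T := fun hm => h hm.2
      push Not at h
      obtain ⟨i, hi, hi0⟩ := h
      have hp : ∏ i ∈ T, (1 + binSign (c i)) = 0 :=
        Finset.prod_eq_zero hi (by simp [binSign, hi0])
      simp [hm, hp]
  · have hm : c ∉ vanishingSubcode C T := fun hm => hc hm.1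
    simp [hc, hm]

/-- Summation over a code, sorted by weight. -/
lemma sum_eq_sum_weightCount (D : Submodule (ZMod 2) (ι → ZMod 2)) [Fintype D]
    (S : Finset ℕ) (hS : ∀ c ∈ D, hammingNorm c ∈ S) (f : ℕ → ℚ) :
    ∑ c : D, f (hammingNorm c.1) = ∑ w ∈ S, weightCount D w * f w := by
  classical
  rw [← Finset.sum_fiberwise_of_maps_to (s := Finset.univ) (t := S)
    (g := fun c : D => hammingNorm c.1) fun c _ => hS c.1 c.2]
  refine Finset.sum_congr rfl fun w _ => ?_
  have hcard : weightCount D w = (Finset.univ.filter fun c : D => hammingNorm c.1 = w).card := by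
    have : {c : ι → ZMod 2 | c ∈ D ∧ hammingNorm c = w} =
        Subtype.val '' {c : D | hammingNorm c.1 = w} := by
      ext c; simp [and_comm]
    rw [weightCount, this, Set.ncard_image_of_injective _ Subtype.val_injective,
      ← Set.ncard_coe_finset]
    simp
  rw [hcard, Finset.sum_congr rfl (g := fun _ => f w)
    (fun c hc => by rw [(Finset.mem_filter.1 hc).2])]
  simp

lemma weightCount_ne_zero {D : Submodule (ZMod 2) (ι → ZMod 2)} {c : ι → ZMod 2} (hc : c ∈ D) :
    weightCount D (hammingNorm c) ≠ 0 :=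
  Set.ncard_ne_zero_of_mem (a := c) ⟨hc, rfl⟩ (Set.toFinite _)

lemma exists_mem_of_weightCount_ne_zero {D : Submodule (ZMod 2) (ι → ZMod 2)} {w : ℕ}
    (h : weightCount D w ≠ 0) : ∃ c ∈ D, hammingNorm c = w :=
  Set.nonempty_of_ncard_ne_zero h

lemma weightCount_zero (D : Submodule (ZMod 2) (ι → ZMod 2)) : weightCount D 0 = 1 := by
  rw [weightCount, Set.ncard_eq_one]
  exact ⟨0, by ext c; simp only [Set.mem_ofPred_eq, hammingNorm_eq_zero, Set.mem_singleton_iff]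
               exact ⟨fun h => h.2, fun h => ⟨h ▸ D.zero_mem, h⟩⟩⟩

lemma eq_one_of_hammingNorm_eq_card {c : ι → ZMod 2} (h : hammingNorm c = Fintype.card ι) :
    c = 1 := by
  have h1 := Finset.card_filter_eq_iff.1 h
  have h2 : ∀ a : ZMod 2, a ≠ 0 → a = 1 := by decide
  exact funext fun i => h2 _ (h1 i (Finset.mem_univ i))

end Moments

/-! ### Shortening preserves weights -/

section Shortening

variable {ι : Type*} [Fintype ι] [DecidableEq ι]

lemma hammingNorm_restrict {T : Finset ι} {c : ι → ZMod 2} (hc : ∀ i ∈ T, c i = 0) :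
    hammingNorm (fun i : {i // i ∉ T} => c i) = hammingNorm c := by
  unfold hammingNorm
  rw [← Finset.card_map (Function.Embedding.subtype _)]
  congr 1
  ext i
  simp only [Finset.mem_map, Finset.mem_filter, Finset.mem_univ, true_and,
    Function.Embedding.subtype_apply, Subtype.exists, exists_and_right, exists_eq_right]
  exact ⟨fun ⟨_, h⟩ => h, fun h => ⟨fun hi => h (hc i hi), h⟩⟩

lemma weightCount_shortenedCode (C : Submodule (ZMod 2) (ι → ZMod 2)) (T : Finset ι) (w : ℕ) :
    weightCount (shortenedCode C T) w = weightCount (vanishingSubcode C T) w := by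
  unfold weightCount
  have himage : {c | c ∈ shortenedCode C T ∧ hammingNorm c = w} =
      (fun (c : ι → ZMod 2) (i : {i // i ∉ T}) => c i) ''
        {c | c ∈ vanishingSubcode C T ∧ hammingNorm c = w} := by
    ext x
    constructor
    · rintro ⟨⟨c, hc, rfl⟩, hw⟩
      exact ⟨c, ⟨hc, (hammingNorm_restrict hc.2).symm.trans hw⟩, rfl⟩
    · rintro ⟨c, ⟨hc, hw⟩, rfl⟩
      exact ⟨⟨c, hc, rfl⟩, (hammingNorm_restrict hc.2).trans hw⟩
  rw [himage]
  refine Set.InjOn.ncard_image fun a ha b hb hab => ?_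
  ext i
  by_cases hi : i ∈ T
  · rw [ha.1.2 i hi, hb.1.2 i hi]
  · exact congrFun hab ⟨i, hi⟩

end Shortening

/-! ### Codes with three nonzero weights -/

/-- The weight distribution of a code with three nonzero weights. -/
def threeWeightTable (w₁ w₂ w₃ : ℕ) (a₁ a₂ a₃ : ℚ) (w : ℕ) : ℚ :=
  if w = 0 then 1 else if w = w₁ then a₁ else if w = w₂ then a₂ else if w = w₃ then a₃ else 0

section ThreeWeights

variable {ι : Type*} [Fintype ι] {D : Submodule (ZMod 2) (ι → ZMod 2)} {w₁ w₂ w₃ : ℕ}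
  {a₁ a₂ a₃ : ℚ}

lemma sum_of_three_weights [Fintype D] (h₁ : 0 < w₁) (h₂ : w₁ < w₂) (h₃ : w₂ < w₃)
    (hD : ∀ c ∈ D, hammingNorm c ∈ ({0, w₁, w₂, w₃} : Finset ℕ)) (f : ℕ → ℚ) :
    ∑ c : D, f (hammingNorm c.1) = f 0 + weightCount D w₁ * f w₁ + weightCount D w₂ * f w₂ +
      weightCount D w₃ * f w₃ := by
  rw [sum_eq_sum_weightCount D _ hD f, Finset.sum_insert (by simp; omega),
    Finset.sum_insert (by simp; omega), Finset.sum_insert (by simp; omega),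
    Finset.sum_singleton, weightCount_zero]
  push_cast
  ring

lemma isLinearCodeWithParams_of_three_weights (h₁ : 0 < w₁) (h₂ : w₁ < w₂) (h₃ : w₂ < w₃)
    (hD : HasWeightDistribution D (threeWeightTable w₁ w₂ w₃ a₁ a₂ a₃)) {n k : ℕ}
    (hn : Fintype.card ι = n) (hpos : 0 < a₁) (hk : 1 + a₁ + a₂ + a₃ = 2 ^ k) :
    IsLinearCodeWithParams D n k w₁ := by
  classical
  have : Fintype D := Fintype.ofFinite D
  have hw : ∀ c ∈ D, hammingNorm c ∈ ({0, w₁, w₂, w₃} : Finset ℕ) := by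
    intro c hc
    by_contra h
    simp only [Finset.mem_insert, Finset.mem_singleton, not_or] at h
    have h' := hD (hammingNorm c)
    rw [threeWeightTable, if_neg h.1, if_neg h.2.1, if_neg h.2.2.1, if_neg h.2.2.2] at h'
    exact weightCount_ne_zero hc (by exact_mod_cast h')
  have e₁ := hD w₁
  have e₂ := hD w₂
  have e₃ := hD w₃
  rw [threeWeightTable, if_neg (by omega), if_pos rfl] at e₁
  rw [threeWeightTable, if_neg (by omega), if_neg (by omega), if_pos rfl] at e₂
  rw [threeWeightTable, if_neg (by omega), if_neg (by omega), if_neg (by omega), if_pos rfl] at e₃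
  refine ⟨hn, ?_, ?_, ?_⟩
  · have hs := sum_of_three_weights h₁ h₂ h₃ hw fun _ => 1
    simp only [Finset.sum_const, Finset.card_univ, nsmul_eq_mul, mul_one, e₁, e₂, e₃, hk] at hs
    have hc : Fintype.card D = 2 ^ k := by exact_mod_cast hs
    rw [Module.card_eq_pow_finrank (K := ZMod 2), ZMod.card] at hc
    exact Nat.pow_right_injective le_rfl hc
  · obtain ⟨c, hc, hcw⟩ := exists_mem_of_weightCount_ne_zero (D := D) (w := w₁) (by
      intro h; rw [h] at e₁; simp at e₁; linarith)
    refine ⟨c, hc, 0, D.zero_mem, ?_, by rw [hammingDist_zero_right, hcw]⟩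
    rintro rfl
    simp at hcw
    omega
  · rintro r ⟨x, hx, y, hy, hxy, rfl⟩
    have hne : hammingNorm (-x + y) ≠ 0 := by simpa [neg_add_eq_zero] using hxy
    have := hw _ (D.add_mem (D.neg_mem hx) hy)
    rw [hammingDist_eq_hammingNorm]
    rw [Finset.mem_insert, Finset.mem_insert, Finset.mem_insert, Finset.mem_singleton] at this
    omega

end ThreeWeights

/-! ### Moments of the shortened code -/

section Moments

variable {ι : Type*} [Fintype ι] [DecidableEq ι] {C : Submodule (ZMod 2) (ι → ZMod 2)} [Fintype C]

lemma moments_vanishingSubcode_one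
    (h4 : ∀ i j k l : ι, fourthSum C i j k l = Fintype.card C * pairing i j k l)
    (hone : (1 : ι → ZMod 2) ∈ C) {T : Finset ι} (hT : T.card = 1)
    [Fintype (vanishingSubcode C T)] :
    2 * ∑ _c : vanishingSubcode C T, (1 : ℚ) = Fintype.card C ∧
    2 * ∑ c : vanishingSubcode C T, signSum c.1 = Fintype.card C ∧
    2 * ∑ c : vanishingSubcode C T, signSum c.1 ^ 2 = Fintype.card ι * Fintype.card C := by
  have e0 := two_pow_mul_sum_vanishingSubcode (C := C) T fun _ => 1
  have e1 := two_pow_mul_sum_vanishingSubcode (C := C) T signSum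
  have e2 := two_pow_mul_sum_vanishingSubcode (C := C) T fun c => signSum c ^ 2
  rw [hT, pow_one] at e0 e1 e2
  rw [e0, e1, e2]
  obtain ⟨a, rfl⟩ := Finset.card_eq_one.1 hT
  simp only [Finset.prod_singleton, add_mul, one_mul, mul_one, Finset.sum_add_distrib,
    sum_sign hone, sum_signSum hone, sum_signSum_sq h4, sum_sign_mul_signSum h4,
    sum_sign_mul_signSum_sq hone]
  simp

lemma moments_vanishingSubcode_two
    (h4 : ∀ i j k l : ι, fourthSum C i j k l = Fintype.card C * pairing i j k l)
    (hone : (1 : ι → ZMod 2) ∈ C) {T : Finset ι} (hT : T.card = 2)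
    [Fintype (vanishingSubcode C T)] :
    4 * ∑ _c : vanishingSubcode C T, (1 : ℚ) = Fintype.card C ∧
    4 * ∑ c : vanishingSubcode C T, signSum c.1 = 2 * Fintype.card C ∧
    4 * ∑ c : vanishingSubcode C T, signSum c.1 ^ 2 =
      (Fintype.card ι + 2) * Fintype.card C := by
  have e0 := two_pow_mul_sum_vanishingSubcode (C := C) T fun _ => 1
  have e1 := two_pow_mul_sum_vanishingSubcode (C := C) T signSum
  have e2 := two_pow_mul_sum_vanishingSubcode (C := C) T fun c => signSum c ^ 2
  rw [hT, show (2 : ℚ) ^ 2 = 4 by norm_num] at e0 e1 e2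
  rw [e0, e1, e2]
  obtain ⟨a, b, hab, rfl⟩ := Finset.card_eq_two.1 hT
  simp only [Finset.prod_pair hab, add_mul, mul_add, one_mul, mul_one, Finset.sum_add_distrib,
    sum_sign hone, sum_signSum hone, sum_signSum_sq h4, sum_sign_mul_signSum h4,
    sum_sign_mul_signSum_sq hone, sum_two_signs h4 hab, sum_two_signs_mul_signSum hone,
    sum_two_signs_mul_signSum_sq h4 hab]
  refine ⟨by simp, by ring, by ring⟩

lemma moments_vanishingSubcode_three
    (h4 : ∀ i j k l : ι, fourthSum C i j k l = Fintype.card C * pairing i j k l)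
    (hone : (1 : ι → ZMod 2) ∈ C) {T : Finset ι} (hT : T.card = 3)
    [Fintype (vanishingSubcode C T)] :
    8 * ∑ _c : vanishingSubcode C T, (1 : ℚ) = Fintype.card C ∧
    8 * ∑ c : vanishingSubcode C T, signSum c.1 = 3 * Fintype.card C ∧
    8 * ∑ c : vanishingSubcode C T, signSum c.1 ^ 2 =
      (Fintype.card ι + 6) * Fintype.card C := by
  have e0 := two_pow_mul_sum_vanishingSubcode (C := C) T fun _ => 1
  have e1 := two_pow_mul_sum_vanishingSubcode (C := C) T signSum
  have e2 := two_pow_mul_sum_vanishingSubcode (C := C) T fun c => signSum c ^ 2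
  rw [hT, show (2 : ℚ) ^ 3 = 8 by norm_num] at e0 e1 e2
  rw [e0, e1, e2]
  obtain ⟨a, b, d, hab, had, hbd, rfl⟩ := Finset.card_eq_three.1 hT
  have hprod : ∀ g : ι → ℚ, ∏ i ∈ {a, b, d}, (1 + g i) =
      1 + g a + g b + g d + g a * g b + g a * g d + g b * g d + g a * g b * g d := fun g => by
    rw [Finset.prod_insert (by simp [hab, had]), Finset.prod_pair hbd]; ring
  simp only [hprod fun i => binSign _, add_mul, one_mul, mul_one, Finset.sum_add_distrib,
    sum_sign hone, sum_signSum hone, sum_signSum_sq h4, sum_sign_mul_signSum h4,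
    sum_sign_mul_signSum_sq hone, sum_two_signs h4 hab, sum_two_signs h4 had,
    sum_two_signs h4 hbd, sum_two_signs_mul_signSum hone,
    sum_two_signs_mul_signSum_sq h4 hab, sum_two_signs_mul_signSum_sq h4 had,
    sum_two_signs_mul_signSum_sq h4 hbd, sum_three_signs hone,
    sum_three_signs_mul_signSum h4 hab had hbd, sum_three_signs_mul_signSum_sq hone]
  refine ⟨by simp, by ring, by ring⟩

omit [Fintype C] in
/-- The multiplicities of three weights placed symmetrically around half the length are determined
by the first three moments. -/
lemma hasWeightDistribution_shortenedCode {p : ℕ} (hp : 0 < p)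
    (hlen : Fintype.card ι = 32 * p ^ 2)
    (hC : ∀ c ∈ C, hammingNorm c ∈
      ({0, 16 * p ^ 2 - 4 * p, 16 * p ^ 2, 16 * p ^ 2 + 4 * p, 32 * p ^ 2} : Finset ℕ))
    {T : Finset ι} (hT : T.Nonempty) [Fintype (vanishingSubcode C T)] {M₀ M₁ M₂ a₁ a₂ a₃ : ℚ}
    (h₀ : ∑ _c : vanishingSubcode C T, (1 : ℚ) = M₀)
    (h₁ : ∑ c : vanishingSubcode C T, signSum c.1 = M₁)
    (h₂ : ∑ c : vanishingSubcode C T, signSum c.1 ^ 2 = M₂)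
    (ha₁ : 128 * (p : ℚ) ^ 2 * a₁ = M₂ - 1024 * (p : ℚ) ^ 4 + 8 * p * (M₁ - 32 * (p : ℚ) ^ 2))
    (ha₃ : 128 * (p : ℚ) ^ 2 * a₃ = M₂ - 1024 * (p : ℚ) ^ 4 - 8 * p * (M₁ - 32 * (p : ℚ) ^ 2))
    (ha : 1 + a₁ + a₂ + a₃ = M₀) :
    HasWeightDistribution (shortenedCode C T)
      (threeWeightTable (16 * p ^ 2 - 4 * p) (16 * p ^ 2) (16 * p ^ 2 + 4 * p) a₁ a₂ a₃) := by
  have hpp : p ≤ p ^ 2 := Nat.le_self_pow two_ne_zero p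
  have hD : ∀ c ∈ vanishingSubcode C T, hammingNorm c ∈
      ({0, 16 * p ^ 2 - 4 * p, 16 * p ^ 2, 16 * p ^ 2 + 4 * p} : Finset ℕ) := by
    intro c hc
    have hne : hammingNorm c ≠ 32 * p ^ 2 := by
      intro h
      obtain ⟨i, hi⟩ := hT
      have h1 := hc.2 i hi
      rw [eq_one_of_hammingNorm_eq_card (h.trans hlen.symm)] at h1
      exact one_ne_zero h1
    have h := hC c hc.1
    simp only [Finset.mem_insert, Finset.mem_singleton, hne, or_false] at h ⊢
    exact h
  have hw₁ : 0 < 16 * p ^ 2 - 4 * p := by omega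
  have hw₂ : 16 * p ^ 2 - 4 * p < 16 * p ^ 2 := by omega
  have hw₃ : 16 * p ^ 2 < 16 * p ^ 2 + 4 * p := by omega
  have hcast : ((16 * p ^ 2 - 4 * p : ℕ) : ℚ) = 16 * (p : ℚ) ^ 2 - 4 * p := by
    rw [Nat.cast_sub (by omega)]; push_cast; ring
  have e₀ := sum_of_three_weights hw₁ hw₂ hw₃ hD fun _ => 1
  have e₁ := sum_of_three_weights hw₁ hw₂ hw₃ hD fun w => 32 * (p : ℚ) ^ 2 - 2 * w
  have e₂ := sum_of_three_weights hw₁ hw₂ hw₃ hD fun w => (32 * (p : ℚ) ^ 2 - 2 * w) ^ 2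
  simp only [signSum_eq, hlen] at h₁ h₂
  push_cast at h₁ h₂
  rw [h₀] at e₀
  rw [h₁, hcast] at e₁
  rw [h₂, hcast] at e₂
  push_cast at e₁ e₂
  -- On the three nonzero weights `S` is `8p`, `0`, `-8p`. The polynomial `S² + 8pS` vanishes at the
  -- last two and is `128p²` at the first, so its sum isolates `a₁`; `S² - 8pS` isolates `a₃`. The
  -- zero word, with `S = 32p²`, accounts for the subtracted terms.
  have hp2 : 128 * (p : ℚ) ^ 2 ≠ 0 := by positivity
  have b₁ : (weightCount (vanishingSubcode C T) (16 * p ^ 2 - 4 * p) : ℚ) = a₁ :=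
    mul_left_cancel₀ hp2 (by linear_combination -ha₁ - e₂ - 8 * p * e₁)
  have b₃ : (weightCount (vanishingSubcode C T) (16 * p ^ 2 + 4 * p) : ℚ) = a₃ :=
    mul_left_cancel₀ hp2 (by linear_combination -ha₃ - e₂ + 8 * p * e₁)
  have b₂ : (weightCount (vanishingSubcode C T) (16 * p ^ 2) : ℚ) = a₂ := by
    linear_combination -ha - e₀ - b₁ - b₃
  intro w
  rw [weightCount_shortenedCode]
  unfold threeWeightTable
  split_ifs with k₀ k₁ k₂ k₃
  · rw [k₀, weightCount_zero]; norm_num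
  · rw [k₁, b₁]
  · rw [k₂, b₂]
  · rw [k₃, b₃]
  · by_contra h
    obtain ⟨c, hc, rfl⟩ := exists_mem_of_weightCount_ne_zero (by exact_mod_cast h)
    have h' := hD c hc
    simp only [Finset.mem_insert, Finset.mem_singleton] at h'
    tauto

end Moments

/-! ### The tables as polynomials in `p = 2 ^ i`, where `m = 2 * i + 5` -/

section Tables

/-- The weights and multiplicities of the given code, in terms of `p = 2 ^ ((m - 5) / 2)`. -/
lemma weightTable_eq (i w : ℕ) : weightTable (2 * i + 5) w =
    if w = 0 then 1
    else if w = 16 * (2 ^ i) ^ 2 - 4 * 2 ^ i then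
      (32 * ((2 : ℚ) ^ i) ^ 2 - 1) * (16 * (2 ^ i) ^ 2)
    else if w = 16 * (2 ^ i) ^ 2 then (32 * ((2 : ℚ) ^ i) ^ 2 - 1) * (32 * (2 ^ i) ^ 2 + 2)
    else if w = 16 * (2 ^ i) ^ 2 + 4 * 2 ^ i then
      (32 * ((2 : ℚ) ^ i) ^ 2 - 1) * (16 * (2 ^ i) ^ 2)
    else if w = 32 * (2 ^ i) ^ 2 then 1
    else 0 := by
  have e₁ : 2 * i + 5 - 1 = i * 2 + 4 := by omega
  have e₂ : (i * 2 + 4) / 2 = i + 2 := by omega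
  have e₃ : 2 * i + 5 = i * 2 + 5 := by omega
  simp only [weightTable, e₁, e₂]
  simp only [e₃, pow_add, pow_mul]
  norm_num [mul_comm]
  ring_nf

lemma weightTableOne_eq (i : ℕ) : weightTableOne (2 * i + 5) =
    threeWeightTable (16 * (2 ^ i) ^ 2 - 4 * 2 ^ i) (16 * (2 ^ i) ^ 2)
      (16 * (2 ^ i) ^ 2 + 4 * 2 ^ i)
      (2 ^ i * (32 * (2 ^ i) ^ 2 - 1) * (2 + 8 * 2 ^ i))
      (-1 + 16 * (2 ^ i) ^ 2 + 512 * (2 ^ i) ^ 4)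
      (2 ^ i * (32 * (2 ^ i) ^ 2 - 1) * (-2 + 8 * 2 ^ i)) := by
  funext w
  have e₁ : 2 * i + 5 - 1 = i * 2 + 4 := by omega
  have e₂ : (i * 2 + 4) / 2 = i + 2 := by omega
  have e₃ : (2 : ℚ) ^ (2 * i + 5) = 32 * (2 ^ i) ^ 2 := by ring
  have e₄ : (2 * i + 5 - 5) / 2 = i := by omega
  have e₅ : (1 + (2 * i + 5)) / 2 = i + 3 := by omega
  have e₆ : 2 * (2 * i + 5) - 1 = i * 4 + 9 := by omega
  simp only [weightTableOne, threeWeightTable, e₁, e₂, e₃, e₄, e₅, e₆, pow_add, pow_mul]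
  norm_num [mul_comm]

lemma weightTableTwo_eq (i : ℕ) : weightTableTwo (2 * i + 5) =
    threeWeightTable (16 * (2 ^ i) ^ 2 - 4 * 2 ^ i) (16 * (2 ^ i) ^ 2)
      (16 * (2 ^ i) ^ 2 + 4 * 2 ^ i)
      (2 ^ i / 2 * (-4 + 128 * (2 ^ i) ^ 2 + 256 * (2 ^ i) ^ 3))
      (-1 + 256 * (2 ^ i) ^ 4)
      (2 ^ i / 2 * (4 - 128 * (2 ^ i) ^ 2 + 256 * (2 ^ i) ^ 3)) := by
  funext w
  have e₁ : 2 * i + 5 - 1 = i * 2 + 4 := by omega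
  have e₂ : (i * 2 + 4) / 2 = i + 2 := by omega
  have e₄ : (((2 * i + 5 : ℕ) : ℤ) - 7) / 2 = i - 1 := by omega
  have e₅ : 2 + (2 * i + 5) = i * 2 + 7 := by omega
  have e₆ : (1 + 3 * (2 * i + 5)) / 2 = i * 3 + 8 := by omega
  have e₇ : 2 * (2 * i + 5) - 2 = i * 4 + 8 := by omega
  have e₈ : (2 : ℚ) ^ ((i : ℤ) - 1) = 2 ^ i / 2 := by
    rw [zpow_sub₀ two_ne_zero, zpow_natCast, zpow_one]
  simp only [weightTableTwo, threeWeightTable, e₁, e₂, e₄, e₅, e₆, e₇, e₈, pow_add, pow_mul]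
  norm_num [mul_comm]

lemma weightTableThree_eq (i : ℕ) : weightTableThree (2 * i + 5) =
    threeWeightTable (16 * (2 ^ i) ^ 2 - 4 * 2 ^ i) (16 * (2 ^ i) ^ 2)
      (16 * (2 ^ i) ^ 2 + 4 * 2 ^ i)
      (-(2 * 2 ^ i) + 3 * (16 * (2 ^ i) ^ 3) + 4 * (2 ^ i) ^ 2 + 64 * (2 ^ i) ^ 4)
      ((-1 + 8 * (2 ^ i) ^ 2) * (1 + 16 * (2 ^ i) ^ 2))
      (2 * 2 ^ i - 3 * (16 * (2 ^ i) ^ 3) + 4 * (2 ^ i) ^ 2 + 64 * (2 ^ i) ^ 4) := by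
  funext w
  have e₁ : 2 * i + 5 - 1 = i * 2 + 4 := by omega
  have e₂ : (i * 2 + 4) / 2 = i + 2 := by omega
  have e₄ : (i * 2 + 2) / 2 = i + 1 := by omega
  have e₅ : (3 * (2 * i + 5) - 7) / 2 = i * 3 + 4 := by omega
  have e₆ : 2 * i + 5 - 3 = i * 2 + 2 := by omega
  have e₇ : 2 * (2 * i + 5) - 4 = i * 4 + 6 := by omega
  have e₈ : 2 * i + 5 - 2 = i * 2 + 3 := by omega
  simp only [weightTableThree, threeWeightTable, e₁, e₂, e₄, e₅, e₆, e₇, e₈, pow_add, pow_mul]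
  norm_num [mul_comm]

end Tables

/-! ### Consequences of the given weight distribution -/

section GivenCode

variable {ι : Type*} [Fintype ι] {C : Submodule (ZMod 2) (ι → ZMod 2)} {i : ℕ}

lemma hammingNorm_mem_of_weightTable (hC : HasWeightDistribution C (weightTable (2 * i + 5)))
    {c : ι → ZMod 2} (hc : c ∈ C) :
    hammingNorm c ∈ ({0, 16 * (2 ^ i) ^ 2 - 4 * 2 ^ i, 16 * (2 ^ i) ^ 2,
      16 * (2 ^ i) ^ 2 + 4 * 2 ^ i, 32 * (2 ^ i) ^ 2} : Finset ℕ) := by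
  by_contra h
  simp only [Finset.mem_insert, Finset.mem_singleton, not_or] at h
  have h' := hC (hammingNorm c)
  rw [weightTable_eq, if_neg h.1, if_neg h.2.1, if_neg h.2.2.1, if_neg h.2.2.2.1,
    if_neg h.2.2.2.2] at h'
  exact weightCount_ne_zero hc (by exact_mod_cast h')

lemma sum_of_weightTable [Fintype C] (hC : HasWeightDistribution C (weightTable (2 * i + 5)))
    (f : ℕ → ℚ) :
    ∑ c : C, f (hammingNorm c.1) = f 0 +
      (32 * ((2 : ℚ) ^ i) ^ 2 - 1) * (16 * (2 ^ i) ^ 2) * f (16 * (2 ^ i) ^ 2 - 4 * 2 ^ i) +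
      (32 * ((2 : ℚ) ^ i) ^ 2 - 1) * (32 * (2 ^ i) ^ 2 + 2) * f (16 * (2 ^ i) ^ 2) +
      (32 * ((2 : ℚ) ^ i) ^ 2 - 1) * (16 * (2 ^ i) ^ 2) * f (16 * (2 ^ i) ^ 2 + 4 * 2 ^ i) +
      f (32 * (2 ^ i) ^ 2) := by
  rw [sum_eq_sum_weightCount C _ (fun c hc => hammingNorm_mem_of_weightTable hC hc) f]
  simp only [hC _, weightTable_eq]
  generalize (2 : ℚ) ^ i = q
  have hp : 0 < 2 ^ i := by positivity
  generalize 2 ^ i = p at hp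
  have hpp : p ≤ p ^ 2 := Nat.le_self_pow two_ne_zero p
  rw [Finset.sum_insert (by simp; omega), Finset.sum_insert (by simp; omega),
    Finset.sum_insert (by simp; omega), Finset.sum_insert (by simp; omega),
    Finset.sum_singleton]
  -- With `p²` opaque, distinctness of the five weights is linear in `p` and `r`, given `0 < p ≤ r`.
  generalize p ^ 2 = r at hpp
  have n₁ : 16 * r - 4 * p ≠ 0 := by omega
  have n₂ : 16 * r ≠ 0 := by omega
  have n₃ : 16 * r + 4 * p ≠ 0 := by omega
  have n₄ : 32 * r ≠ 0 := by omega
  have n₅ : 16 * r ≠ 16 * r - 4 * p := by omega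
  have n₆ : 16 * r + 4 * p ≠ 16 * r - 4 * p := by omega
  have n₇ : 32 * r ≠ 16 * r - 4 * p := by omega
  have n₈ : 16 * r + 4 * p ≠ 16 * r := by omega
  have n₉ : 32 * r ≠ 16 * r := by omega
  have n₁₀ : 32 * r ≠ 16 * r + 4 * p := by omega
  simp only [if_true, if_neg n₁, if_neg n₂, if_neg n₃, if_neg n₄, if_neg n₅, if_neg n₆, if_neg n₇,
    if_neg n₈, if_neg n₉, if_neg n₁₀, one_mul]
  ring

lemma card_of_weightTable [Fintype C] (hC : HasWeightDistribution C (weightTable (2 * i + 5))) :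
    (Fintype.card C : ℚ) = 2048 * (2 ^ i) ^ 4 := by
  have h := sum_of_weightTable hC fun _ => 1
  simp only [Finset.sum_const, Finset.card_univ, nsmul_eq_mul, mul_one] at h
  rw [h]
  ring

lemma one_mem_of_weightTable (hlen : Fintype.card ι = 32 * (2 ^ i) ^ 2)
    (hC : HasWeightDistribution C (weightTable (2 * i + 5))) : (1 : ι → ZMod 2) ∈ C := by
  have hp : 0 < 2 ^ i := by positivity
  have hpp : 2 ^ i ≤ (2 ^ i) ^ 2 := Nat.le_self_pow two_ne_zero _
  have h := hC (32 * (2 ^ i) ^ 2)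
  rw [weightTable_eq, if_neg (by omega), if_neg (by omega), if_neg (by omega), if_neg (by omega),
    if_pos rfl] at h
  obtain ⟨c, hc, hcw⟩ := exists_mem_of_weightCount_ne_zero (D := C) (w := 32 * (2 ^ i) ^ 2)
    (by intro h0; rw [h0] at h; norm_num at h)
  rwa [eq_one_of_hammingNorm_eq_card (hcw.trans hlen.symm)] at hc

/-- The fourth moment is `2n⁴ + n(n - 1)(8p)⁴` with `n = 32p²`, which equals `2n²(3n² - 2n)`, and
`|C| = 2n²`: the extremal value. -/
lemma fourthSum_of_weightTable [DecidableEq ι] [Fintype C]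
    (hlen : Fintype.card ι = 32 * (2 ^ i) ^ 2)
    (hC : HasWeightDistribution C (weightTable (2 * i + 5))) (a b c d : ι) :
    fourthSum C a b c d = Fintype.card C * pairing a b c d := by
  refine fourthSum_eq C ?_ a b c d
  have hpp : 2 ^ i ≤ (2 ^ i) ^ 2 := Nat.le_self_pow two_ne_zero _
  have hcast : ((16 * (2 ^ i) ^ 2 - 4 * 2 ^ i : ℕ) : ℚ) = 16 * (2 ^ i) ^ 2 - 4 * 2 ^ i := by
    rw [Nat.cast_sub (by omega)]; push_cast; ring
  have h := sum_of_weightTable hC fun w => (32 * ((2 : ℚ) ^ i) ^ 2 - 2 * w) ^ 4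
  simp only [signSum_eq, hlen, card_of_weightTable hC]
  rw [hcast] at h
  push_cast at h ⊢
  rw [h]
  ring

end GivenCode

/-! ### The three shortened codes -/

theorem mainTheorem8 (m : ℕ) (hm : 5 ≤ m) (hodd : Odd m)
    {ι : Type*} [Fintype ι] [DecidableEq ι] (hlen : Fintype.card ι = 2 ^ m)
    (C : Submodule (ZMod 2) (ι → ZMod 2)) (hC : HasWeightDistribution C (weightTable m))
    (T : Finset ι) :
    (T.card = 1 →
      IsLinearCodeWithParams (shortenedCode C T)
        (2 ^ m - 1) (2 * m) (2 ^ (m - 1) - 2 ^ ((m - 1) / 2)) ∧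
      HasWeightDistribution (shortenedCode C T) (weightTableOne m)) ∧
    (T.card = 2 →
      IsLinearCodeWithParams (shortenedCode C T)
        (2 ^ m - 2) (2 * m - 1) (2 ^ (m - 1) - 2 ^ ((m - 1) / 2)) ∧
      HasWeightDistribution (shortenedCode C T) (weightTableTwo m)) ∧
    (T.card = 3 →
      IsLinearCodeWithParams (shortenedCode C T)
        (2 ^ m - 3) (2 * m - 2) (2 ^ (m - 1) - 2 ^ ((m - 1) / 2)) ∧
      HasWeightDistribution (shortenedCode C T) (weightTableThree m)) := by
  obtain ⟨j, rfl⟩ := hodd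
  obtain ⟨i, rfl⟩ : ∃ i, j = i + 2 := ⟨j - 2, by omega⟩
  rw [show 2 * (i + 2) + 1 = 2 * i + 5 by ring] at *
  have hpow : 2 ^ (2 * i + 5) = 32 * (2 ^ i) ^ 2 := by ring
  have hw₁ : 2 ^ (2 * i + 5 - 1) - 2 ^ ((2 * i + 5 - 1) / 2) = 16 * (2 ^ i) ^ 2 - 4 * 2 ^ i := by
    rw [show (2 * i + 5 - 1) / 2 = i + 2 by omega, show 2 * i + 5 - 1 = i * 2 + 4 by omega,
      pow_add, pow_add, pow_mul]
    ring_nf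
  have hlen' : Fintype.card ι = 32 * (2 ^ i) ^ 2 := hlen.trans hpow
  classical
  have : Fintype C := Fintype.ofFinite C
  have : Fintype (vanishingSubcode C T) := Fintype.ofFinite _
  have h4 := fourthSum_of_weightTable hlen' hC
  have hone := one_mem_of_weightTable hlen' hC
  have hcard := card_of_weightTable hC
  have hlenQ : (Fintype.card ι : ℚ) = 32 * (2 ^ i) ^ 2 := by rw [hlen']; push_cast; ring
  have hp : 0 < 2 ^ i := by positivity
  have hpp : 2 ^ i ≤ (2 ^ i) ^ 2 := Nat.le_self_pow two_ne_zero _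
  have hq : (1 : ℚ) ≤ 2 ^ i := one_le_pow₀ (by norm_num)
  have hw := fun c hc => hammingNorm_mem_of_weightTable hC (c := c) hc
  have hlenT : Fintype.card {x // x ∉ T} = 2 ^ (2 * i + 5) - T.card := by
    rw [Fintype.card_subtype_compl, hlen, Fintype.card_coe]
  rw [hw₁, weightTableOne_eq, weightTableTwo_eq, weightTableThree_eq]
  refine ⟨fun hT => ?_, fun hT => ?_, fun hT => ?_⟩
  all_goals
    have hne : T.Nonempty := Finset.card_pos.1 (by omega)
    rw [hT] at hlenT
    -- The code parameters follow from the distribution once `a₁ > 0` and the multiplicities sum to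
    -- a power of two, so only the distribution needs the moments.
    refine and_iff_right_of_imp (fun hD => isLinearCodeWithParams_of_three_weights (by omega)
      (by omega) (by omega) hD hlenT ?_ ?_) |>.2 ?_
  · have : (0 : ℚ) < 32 * (2 ^ i) ^ 2 - 1 := by nlinarith
    positivity
  · rw [show 2 * (2 * i + 5) = i * 4 + 10 by ring, pow_add, pow_mul]
    ring
  · obtain ⟨s₀, s₁, s₂⟩ := moments_vanishingSubcode_one h4 hone hT
    rw [hcard] at s₀ s₁ s₂
    rw [hlenQ] at s₂
    -- Here and in the other two cases, the moments are those of the indicator expansion divided by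
    -- `2 ^ t`, with `|C| = 2048p⁴`.
    refine hasWeightDistribution_shortenedCode hp hlen' hw hne (M₀ := 1024 * (2 ^ i) ^ 4)
      (M₁ := 1024 * (2 ^ i) ^ 4) (M₂ := 32 * (2 ^ i) ^ 2 * (1024 * (2 ^ i) ^ 4))
      (by linarith) (by linarith) (by linarith) ?_ ?_ ?_ <;> push_cast <;> ring
  · have : (0 : ℚ) < -4 + 128 * (2 ^ i) ^ 2 := by nlinarith
    positivity
  · rw [show 2 * (2 * i + 5) - 1 = i * 4 + 9 by omega, pow_add, pow_mul]
    ring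
  · obtain ⟨s₀, s₁, s₂⟩ := moments_vanishingSubcode_two h4 hone hT
    rw [hcard] at s₀ s₁ s₂
    rw [hlenQ] at s₂
    refine hasWeightDistribution_shortenedCode hp hlen' hw hne (M₀ := 512 * (2 ^ i) ^ 4)
      (M₁ := 1024 * (2 ^ i) ^ 4) (M₂ := (32 * (2 ^ i) ^ 2 + 2) * (512 * (2 ^ i) ^ 4))
      (by linarith) (by linarith) (by linarith) ?_ ?_ ?_ <;> push_cast <;> ring
  · have : (0 : ℚ) < -(2 * 2 ^ i) + 4 * (2 ^ i) ^ 2 := by nlinarith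
    have : (0 : ℚ) < 3 * (16 * (2 ^ i) ^ 3) + 64 * (2 ^ i) ^ 4 := by positivity
    linarith
  · rw [show 2 * (2 * i + 5) - 2 = i * 4 + 8 by omega, pow_add, pow_mul]
    ring
  · obtain ⟨s₀, s₁, s₂⟩ := moments_vanishingSubcode_three h4 hone hT
    rw [hcard] at s₀ s₁ s₂
    rw [hlenQ] at s₂
    refine hasWeightDistribution_shortenedCode hp hlen' hw hne (M₀ := 256 * (2 ^ i) ^ 4)
      (M₁ := 768 * (2 ^ i) ^ 4) (M₂ := (32 * (2 ^ i) ^ 2 + 6) * (256 * (2 ^ i) ^ 4))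
      (by linarith) (by linarith) (by linarith) ?_ ?_ ?_ <;> push_cast <;> ring
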